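/- Call a sequence $(U_n)_{n\in\mathbb N}$ of subsets of $\mathbb N$ a c.e. trace if the sets $U_n$ are finite and uniformly computably enumerable, and call it $h$-bounded, for $h:\mathbb N\to\mathbb R$, if $|U_n|\le h(n)$ for every $n$. A real $x\in 2^{\omega}$ is called $h$-jump traceable if for each Turing functional $\Phi$ there is an $h$-bounded c.e. trace $(U_n)_{n\in\mathbb N}$ such that, if $\Phi^x$ is total, then $\Phi^x(n)\in U_n$ for all but finitely many $n$. Theorem. Let $\varepsilon$ be a positive rational number. Then the set of reals $x\in 2^{\omega}$ that are $n^{1+\varepsilon}$-jump traceable (that is, $h$-jump traceable for $h(n)=n^{1+\varepsilon}$) has cardinality $2^{\aleph_0}$. -/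

import Mathlib

/-- The real `x ∈ 2^ω`, as a (total) `{0,1}`-valued oracle. -/
def realOracle (x : ℕ → Bool) : ℕ →. ℕ :=
  fun n => Part.some (if x n then 1 else 0)

/-- `U` is an `h`-bounded c.e. trace: the sets `U n` are uniformly computably enumerable, and
each `U n` is finite with at most `h n` elements. -/
def IsBoundedCETrace (h : ℕ → ℝ) (U : ℕ → Set ℕ) : Prop :=
  (REPred fun p : ℕ × ℕ => p.2 ∈ U p.1) ∧
    ∀ n, (U n).Finite ∧ ((U n).ncard : ℝ) ≤ h n

/-- The real `x` is `h`-jump traceable. The functions `Φ^x`, for Turing functionals `Φ`, are exactly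
the partial functions `φ` that are recursive in `x`. -/
def IsJumpTraceable (h : ℕ → ℝ) (x : ℕ → Bool) : Prop :=
  ∀ φ : ℕ →. ℕ, Nat.RecursiveIn {realOracle x} φ →
    ∃ U : ℕ → Set ℕ, IsBoundedCETrace h U ∧
      ((∀ n, (φ n).Dom) → ∀ᶠ n in Filter.atTop, ∃ v ∈ φ n, v ∈ U n)

/-! The argument is forcing with computable perfect trees. Given a tree and a functional, either
some node has no extension in the tree on which a certain input converges, and the functional is
partial on every branch above that node; or convergence is dense, and a computable subtree can be
thinned so that its nodes of level `l` already decide all inputs below `2 ^ (l + 1)`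
(`exists_subtree_tracedAt`). In the second case the value at `n` is fixed by one of the `2 ^ Nat.log
2 n ≤ n` nodes of level `Nat.log 2 n`, so these values form a c.e. trace bounded by `n`, hence by `n
^ (1 + ε)`. There are countably many functionals, so they can be treated in turn along a decreasing
sequence of trees; each tree is computable, but the sequence need not be. Between two stages one bit
of `α` chooses a side of the split at the root. The resulting real determines `α`, which gives
continuum many traceable reals. -/

/-- The initial segment of length `k` of the real `x`. -/
def initSeg (x : ℕ → Bool) (k : ℕ) : List Bool := (List.range k).map x

@[simp] theorem length_initSeg (x : ℕ → Bool) (k : ℕ) : (initSeg x k).length = k := by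
  simp [initSeg]

theorem initSeg_prefix (x : ℕ → Bool) {j k : ℕ} (h : j ≤ k) : initSeg x j <+: initSeg x k := by
  obtain ⟨d, rfl⟩ := Nat.exists_eq_add_of_le h
  simp [initSeg, List.range_add]

theorem getElem?_initSeg (x : ℕ → Bool) {i k : ℕ} (h : i < k) :
    (initSeg x k)[i]? = some (x i) := by
  simp [initSeg, h]

theorem eq_initSeg_of_prefix {x : ℕ → Bool} {σ : List Bool} {k : ℕ} (h : σ <+: initSeg x k) :
    σ = initSeg x σ.length := by
  have hl : σ.length ≤ k := by simpa using h.length_le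
  exact (List.prefix_of_prefix_length_le h (initSeg_prefix x hl) (by simp)).eq_of_length (by simp)

/-! ### Relative computability through finite oracles -/

/-- A functional on finite oracles is prefix monotone if extending the oracle preserves
convergent computations. -/
def PrefixMonotone (g : List Bool → ℕ → Option ℕ) : Prop :=
  ∀ ⦃σ τ : List Bool⦄, σ <+: τ → ∀ n v, g σ n = some v → g τ n = some v

/-- The functional `g` on finite oracles computes `φ` on the oracle `x`. -/
def ComputesAt (g : List Bool → ℕ → Option ℕ) (x : ℕ → Bool) (φ : ℕ →. ℕ) : Prop :=
  ∀ n v, v ∈ φ n ↔ ∃ k, g (initSeg x k) n = some v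

theorem PrefixMonotone.exists_iff_eventually {g : List Bool → ℕ → Option ℕ}
    (hg : PrefixMonotone g) (x : ℕ → Bool) (n v : ℕ) :
    (∃ k, g (initSeg x k) n = some v) ↔ ∀ᶠ k in Filter.atTop, g (initSeg x k) n = some v := by
  constructor
  · rintro ⟨k, hk⟩
    filter_upwards [Filter.eventually_ge_atTop k] with j hj
    exact hg (initSeg_prefix x hj) _ _ hk
  · exact fun h => h.exists

theorem ComputesAt.mem_iff {g : List Bool → ℕ → Option ℕ} {x : ℕ → Bool} {φ : ℕ →. ℕ}
    (h : ComputesAt g x φ) (hg : PrefixMonotone g) (n v : ℕ) :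
    v ∈ φ n ↔ ∀ᶠ k in Filter.atTop, g (initSeg x k) n = some v :=
  (h n v).trans (hg.exists_iff_eventually x n v)

/-- Searching for the least `m ≤ σ.length` at which `g σ (Nat.pair a ·)` vanishes, provided that
it converges to a positive value below `m`. -/
def boundedSearch (g : List Bool → ℕ → Option ℕ) (σ : List Bool) (a : ℕ) : Option ℕ :=
  let m := (List.range σ.length).findIdx fun i => (g σ (Nat.pair a i)).getD 0 == 0
  if g σ (Nat.pair a m) = some 0 then some m else none

/-- Divergence is read as `0`, so the search also stops at the first divergent input; the final test
rejects that case. An unsuccessful search returns `σ.length`, which is why `v = σ.length` is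
allowed. -/
theorem boundedSearch_eq_some {g : List Bool → ℕ → Option ℕ} {σ : List Bool} {a v : ℕ} :
    boundedSearch g σ a = some v ↔ v ≤ σ.length ∧ g σ (Nat.pair a v) = some 0 ∧
      ∀ i < v, ∃ u, g σ (Nat.pair a i) = some (u + 1) := by
  have key : ∀ i, (g σ (Nat.pair a i)).getD 0 ≠ 0 ↔ ∃ u, g σ (Nat.pair a i) = some (u + 1) := by
    intro i
    rcases h : g σ (Nat.pair a i) with _ | _ | u <;> simp
  unfold boundedSearch
  simp only []
  constructor
  · intro h
    split_ifs at h with h0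
    rw [Option.some_inj] at h
    subst h
    refine ⟨by simpa using List.findIdx_le_length (xs := List.range σ.length), h0, fun i hi => ?_⟩
    have := List.not_of_lt_findIdx hi
    rw [← key]
    simpa using this
  · rintro ⟨hv, h0, hpos⟩
    have : (List.range σ.length).findIdx (fun i => (g σ (Nat.pair a i)).getD 0 == 0) = v := by
      rcases hv.eq_or_lt with rfl | hv
      · refine (List.findIdx_eq_length.2 fun i hi => ?_).trans (by simp)
        simpa using (key i).2 (hpos i (by simpa using hi))
      · rw [List.findIdx_eq (by simpa using hv)]
        refine ⟨by simp [h0], fun i hi => ?_⟩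
        simpa using (key i).2 (hpos i hi)
    rw [this, if_pos h0]

theorem Primrec₂.boundedSearch {g : List Bool → ℕ → Option ℕ} (hg : Primrec₂ g) :
    Primrec₂ (boundedSearch g) := by
  have hm : Primrec fun p : List Bool × ℕ =>
      (List.range p.1.length).findIdx fun i => (g p.1 (Nat.pair p.2 i)).getD 0 == 0 := by
    refine Primrec.list_findIdx (Primrec.list_range.comp (Primrec.list_length.comp Primrec.fst)) ?_
    refine Primrec.beq.comp (Primrec.option_getD.comp (hg.comp (Primrec.fst.comp Primrec.fst)
      (Primrec₂.natPair.comp (Primrec.snd.comp Primrec.fst) Primrec.snd)) (Primrec.const 0))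
      (Primrec.const 0)
  exact Primrec.ite (Primrec.eq.comp (hg.comp Primrec.fst
    (Primrec₂.natPair.comp Primrec.snd hm)) (Primrec.const (some 0)))
    (Primrec.option_some.comp hm) (Primrec.const none)

/-- The length of the finite oracle doubles as a bound on unbounded searches, so `g` can be
primitive recursive. Monotonicity lets finitely many subcomputations that converge at different
lengths be read off at one common length. -/
theorem exists_primrec_computesAt_of_recursiveIn {x : ℕ → Bool} {φ : ℕ →. ℕ}
    (h : Nat.RecursiveIn {realOracle x} φ) :
    ∃ g : List Bool → ℕ → Option ℕ, Primrec₂ g ∧ PrefixMonotone g ∧ ComputesAt g x φ := by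
  have of_primrec : ∀ f : ℕ → ℕ, Primrec f → ∀ ψ : ℕ →. ℕ, (∀ n, ψ n = Part.some (f n)) →
      ∃ g : List Bool → ℕ → Option ℕ, Primrec₂ g ∧ PrefixMonotone g ∧ ComputesAt g x ψ := by
    intro f hf ψ hψ
    refine ⟨fun _ n => some (f n), Primrec.option_some.comp (hf.comp Primrec.snd),
      fun _ _ _ _ _ h => h, fun n v => ?_⟩
    simp [hψ, eq_comm]
  induction h with
  | zero => exact of_primrec _ (Primrec.const 0) _ fun _ => rfl
  | succ => exact of_primrec Nat.succ Primrec.succ _ fun _ => rfl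
  | left => exact of_primrec _ (Primrec.fst.comp Primrec.unpair) _ fun _ => rfl
  | right => exact of_primrec _ (Primrec.snd.comp Primrec.unpair) _ fun _ => rfl
  | oracle f hf =>
    obtain rfl : f = realOracle x := hf
    refine ⟨fun σ n => σ[n]?.map fun b => cond b 1 0, ?_, ?_, ?_⟩
    · exact Primrec.option_map Primrec.list_getElem?
        ((Primrec.dom_bool fun b => cond b 1 0).comp Primrec.snd)
    · rintro σ _ ⟨τ, rfl⟩ n v hv
      obtain ⟨b, hb, rfl⟩ := Option.map_eq_some_iff.1 hv
      obtain ⟨hn, -⟩ := List.getElem?_eq_some_iff.1 hb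
      simp only [List.getElem?_append_left hn, hb, Option.map_some]
    · intro n v
      constructor
      · intro hv
        refine ⟨n + 1, ?_⟩
        simp only [getElem?_initSeg x n.lt_succ_self]
        have : v = if x n then 1 else 0 := by simpa [realOracle] using hv
        subst this
        cases x n <;> rfl
      · rintro ⟨k, hk⟩
        obtain ⟨b, hb, rfl⟩ := Option.map_eq_some_iff.1 hk
        obtain ⟨hn, -⟩ := List.getElem?_eq_some_iff.1 hb
        rw [getElem?_initSeg x (by simpa using hn)] at hb
        obtain rfl := Option.some_inj.1 hb
        cases h : x n <;> simp [realOracle, h]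
  | @pair f h _ _ ihf ihh =>
    obtain ⟨a, ha, ma, ca⟩ := ihf
    obtain ⟨b, hb, mb, cb⟩ := ihh
    refine ⟨fun σ n => (a σ n).bind fun u => (b σ n).map fun w => Nat.pair u w, ?_, ?_, ?_⟩
    · refine Primrec.option_bind ha (Primrec.option_map (hb.comp (Primrec.fst.comp Primrec.fst)
        (Primrec.snd.comp Primrec.fst)) ?_)
      exact Primrec₂.natPair.comp (Primrec.snd.comp Primrec.fst) Primrec.snd
    · intro σ τ hστ n v hv
      simp only [Option.bind_eq_some_iff, Option.map_eq_some_iff] at hv ⊢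
      obtain ⟨u, hu, w, hw, rfl⟩ := hv
      exact ⟨u, ma hστ _ _ hu, w, mb hστ _ _ hw, rfl⟩
    · intro n v
      have : v ∈ (Nat.pair <$> f n <*> h n) ↔ ∃ u ∈ f n, ∃ w ∈ h n, Nat.pair u w = v := by
        simp [Seq.seq]
      rw [this]
      simp only [Option.bind_eq_some_iff, Option.map_eq_some_iff]
      constructor
      · rintro ⟨u, hu, w, hw, rfl⟩
        rw [ca.mem_iff ma] at hu
        rw [cb.mem_iff mb] at hw
        obtain ⟨k, h1, h2⟩ := (hu.and hw).exists
        exact ⟨k, u, h1, w, h2, rfl⟩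
      · rintro ⟨k, u, h1, w, h2, rfl⟩
        exact ⟨u, (ca _ _).2 ⟨k, h1⟩, w, (cb _ _).2 ⟨k, h2⟩, rfl⟩
  | @comp f h _ _ ihf ihh =>
    obtain ⟨a, ha, ma, ca⟩ := ihf
    obtain ⟨b, hb, mb, cb⟩ := ihh
    refine ⟨fun σ n => (b σ n).bind (a σ), ?_, ?_, ?_⟩
    · exact Primrec.option_bind hb (ha.comp (Primrec.fst.comp Primrec.fst) Primrec.snd)
    · intro σ τ hστ n v hv
      simp only [Option.bind_eq_some_iff] at hv ⊢
      obtain ⟨u, hu, hw⟩ := hv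
      exact ⟨u, mb hστ _ _ hu, ma hστ _ _ hw⟩
    · intro n v
      refine Part.mem_bind_iff.trans ?_
      simp only [Option.bind_eq_some_iff]
      constructor
      · rintro ⟨u, hu, hw⟩
        rw [cb.mem_iff mb] at hu
        rw [ca.mem_iff ma] at hw
        obtain ⟨k, h1, h2⟩ := (hu.and hw).exists
        exact ⟨k, u, h1, h2⟩
      · rintro ⟨k, u, h1, h2⟩
        exact ⟨u, (cb _ _).2 ⟨k, h1⟩, (ca _ _).2 ⟨k, h2⟩⟩
  | @prec f h _ _ ihf ihh =>
    obtain ⟨a, ha, ma, ca⟩ := ihf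
    obtain ⟨b, hb, mb, cb⟩ := ihh
    let r : List Bool → ℕ → ℕ → Option ℕ := fun σ c n =>
      n.rec (a σ c) fun y IH => IH.bind fun i => b σ (Nat.pair c (Nat.pair y i))
    have hr0 : ∀ σ c, r σ c 0 = a σ c := fun _ _ => rfl
    have hrs : ∀ σ c n, r σ c (n + 1) =
      (r σ c n).bind fun i => b σ (Nat.pair c (Nat.pair n i)) := fun _ _ _ => rfl
    have mr : ∀ ⦃σ τ⦄, σ <+: τ → ∀ c n v, r σ c n = some v → r τ c n = some v := by
      intro σ τ hστ c n
      induction n with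
      | zero => exact ma hστ c
      | succ n ih =>
        intro v hv
        simp only [hrs, Option.bind_eq_some_iff] at hv ⊢
        obtain ⟨u, hu, hw⟩ := hv
        exact ⟨u, ih _ hu, mb hστ _ _ hw⟩
    refine ⟨fun σ p => r σ p.unpair.1 p.unpair.2, ?_, fun σ τ hστ n v => mr hστ _ _ v, ?_⟩
    · have h1 : Primrec fun p : List Bool × ℕ => p.2.unpair.1 :=
        Primrec.fst.comp (Primrec.unpair.comp Primrec.snd)
      have h2 : Primrec fun p : List Bool × ℕ => p.2.unpair.2 :=
        Primrec.snd.comp (Primrec.unpair.comp Primrec.snd)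
      refine Primrec.nat_rec' (h := fun p q => q.2.bind fun i =>
        b p.1 (Nat.pair p.2.unpair.1 (Nat.pair q.1 i))) h2 (ha.comp Primrec.fst h1) ?_
      refine Primrec.option_bind (Primrec.snd.comp Primrec.snd) ?_
      refine hb.comp (Primrec.fst.comp (Primrec.fst.comp Primrec.fst)) ?_
      refine Primrec₂.natPair.comp (h1.comp (Primrec.fst.comp Primrec.fst)) ?_
      exact Primrec₂.natPair.comp (Primrec.fst.comp (Primrec.snd.comp Primrec.fst)) Primrec.snd
    · intro p v
      dsimp only
      generalize p.unpair.1 = c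
      generalize p.unpair.2 = n
      induction n generalizing v with
      | zero => exact ca c v
      | succ n ih =>
        refine Part.mem_bind_iff.trans ?_
        simp only [hrs, Option.bind_eq_some_iff]
        constructor
        · rintro ⟨u, hu, hw⟩
          obtain ⟨k, hk⟩ := (ih u).1 hu
          rw [cb.mem_iff mb] at hw
          obtain ⟨j, hj, hkj⟩ := (hw.and (Filter.eventually_ge_atTop k)).exists
          exact ⟨j, u, mr (initSeg_prefix x hkj) _ _ _ hk, hj⟩
        · rintro ⟨k, u, h1, h2⟩
          exact ⟨u, (ih u).2 ⟨k, h1⟩, (cb _ _).2 ⟨k, h2⟩⟩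
  | @rfind f _ ihf =>
    obtain ⟨a, ha, ma, ca⟩ := ihf
    refine ⟨boundedSearch a, ha.boundedSearch, ?_, ?_⟩
    · intro σ τ hστ n v hv
      rw [boundedSearch_eq_some] at hv ⊢
      exact ⟨hv.1.trans hστ.length_le, ma hστ _ _ hv.2.1,
        fun i hi => (hv.2.2 i hi).imp fun u hu => ma hστ _ _ hu⟩
    · intro c v
      have hf : v ∈ Nat.rfind (fun n => (fun m => decide (m = 0)) <$> f (Nat.pair c n)) ↔
          0 ∈ f (Nat.pair c v) ∧ ∀ i < v, ∃ u, u + 1 ∈ f (Nat.pair c i) := by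
        refine Nat.mem_rfind.trans ?_
        refine and_congr (by simp) (forall₂_congr fun i _ => ?_)
        simp only [Part.map_eq_map, Part.mem_map_iff, decide_eq_false_iff_not]
        constructor
        · rintro ⟨u, hu, h0⟩
          obtain ⟨w, rfl⟩ := Nat.exists_eq_succ_of_ne_zero h0
          exact ⟨w, hu⟩
        · rintro ⟨u, hu⟩
          exact ⟨u + 1, hu, by simp⟩
      refine hf.trans ?_
      simp only [boundedSearch_eq_some, length_initSeg]
      constructor
      · rintro ⟨h0, hpos⟩
        choose! u hu using hpos
        rw [ca.mem_iff ma] at h0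
        have hu' : ∀ᶠ k in Filter.atTop, ∀ i ∈ Set.Iio v,
            a (initSeg x k) (Nat.pair c i) = some (u i + 1) :=
          (Filter.eventually_all_finite (Set.finite_Iio v)).2 fun i hi =>
            (ca.mem_iff ma _ _).1 (hu i hi)
        obtain ⟨k, ⟨h1, h2⟩, h3⟩ := ((h0.and hu').and (Filter.eventually_ge_atTop v)).exists
        exact ⟨k, h3, h1, fun i hi => ⟨u i, h2 i hi⟩⟩
      · rintro ⟨k, -, h0, hpos⟩
        exact ⟨(ca _ _).2 ⟨k, h0⟩, fun i hi => (hpos i hi).imp fun u hu => (ca _ _).2 ⟨k, hu⟩⟩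

/-! ### Computable perfect trees -/

/-- A computable perfect tree, given by a computable embedding of the full binary tree. -/
structure IsPerfectTree (T : List Bool → List Bool) : Prop where
  computable : Computable T
  append_prefix : ∀ σ b, T σ ++ [b] <+: T (σ ++ [b])

/-- The real `x` is a branch of the tree `T`. -/
def IsBranch (T : List Bool → List Bool) (x : ℕ → Bool) : Prop :=
  ∀ m, ∃ σ, m ≤ σ.length ∧ T σ = initSeg x (T σ).length

namespace IsPerfectTree

variable {T S : List Bool → List Bool}

theorem mono (hT : IsPerfectTree T) {σ τ : List Bool} (h : σ <+: τ) : T σ <+: T τ := by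
  obtain ⟨ρ, rfl⟩ := h
  induction ρ using List.reverseRecOn with
  | nil => simp
  | append_singleton ρ b ih =>
    rw [← List.append_assoc]
    exact (ih.trans (List.prefix_append _ _)).trans (hT.append_prefix _ _)

theorem length_add_le (hT : IsPerfectTree T) (σ : List Bool) :
    (T []).length + σ.length ≤ (T σ).length := by
  induction σ using List.reverseRecOn with
  | nil => simp
  | append_singleton σ b ih =>
    have := (hT.append_prefix σ b).length_le
    simp only [List.length_append, List.length_singleton] at this ⊢
    omega

theorem length_le (hT : IsPerfectTree T) (σ : List Bool) : σ.length ≤ (T σ).length :=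
  (Nat.le_add_left _ _).trans (hT.length_add_le σ)

theorem comp (hT : IsPerfectTree T) (hS : IsPerfectTree S) : IsPerfectTree fun σ => T (S σ) where
  computable := hT.computable.comp hS.computable
  append_prefix σ b := (hT.append_prefix _ _).trans (hT.mono (hS.append_prefix σ b))

protected theorem id : IsPerfectTree fun σ => σ where
  computable := Computable.id
  append_prefix _ _ := List.prefix_rfl

theorem append_left (ρ : List Bool) : IsPerfectTree fun σ => ρ ++ σ where
  computable := Computable.list_append.comp (Computable.const ρ) Computable.id
  append_prefix σ b := by simp

theorem eq_initSeg_of_prefix (hT : IsPerfectTree T) {x : ℕ → Bool} {σ τ : List Bool}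
    (h : σ <+: τ) (hτ : T τ = initSeg x (T τ).length) : T σ = initSeg x (T σ).length :=
  _root_.eq_initSeg_of_prefix (hτ ▸ hT.mono h)

end IsPerfectTree

/-! ### Subtrees that decide a functional -/

/-- The functional `g` with oracle `σ` converges on all inputs below `N`. -/
def convergesBelow (g : List Bool → ℕ → Option ℕ) (σ : List Bool) (N : ℕ) : Bool :=
  N.rec true fun i r => r && (g σ i).isSome

theorem convergesBelow_iff {g : List Bool → ℕ → Option ℕ} {σ : List Bool} {N : ℕ} :
    convergesBelow g σ N = true ↔ ∀ i < N, (g σ i).isSome := by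
  induction N with
  | zero => simp [convergesBelow]
  | succ N ih =>
    have : convergesBelow g σ (N + 1) = (convergesBelow g σ N && (g σ N).isSome) := rfl
    rw [this, Bool.and_eq_true, ih]
    simp only [Nat.lt_succ_iff_lt_or_eq, or_imp, forall_and, forall_eq]

theorem Computable₂.convergesBelow {g : List Bool → ℕ → Option ℕ} (hg : Computable₂ g) :
    Computable₂ (convergesBelow g) := by
  refine Computable.nat_rec (h := fun p q => q.2 && (g p.1 q.1).isSome) Computable.snd
    (Computable.const true) ?_
  refine Primrec.and.to_comp.comp (Computable.snd.comp Computable.snd)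
    (Primrec.option_isSome.to_comp.comp ?_)
  exact hg.comp (Computable.fst.comp Computable.fst) (Computable.fst.comp Computable.snd)

theorem PrefixMonotone.isSome {g : List Bool → ℕ → Option ℕ} (hg : PrefixMonotone g)
    {σ τ : List Bool} (h : σ <+: τ) {n : ℕ} (hn : (g σ n).isSome) : (g τ n).isSome := by
  obtain ⟨v, hv⟩ := Option.isSome_iff_exists.1 hn
  exact Option.isSome_iff_exists.2 ⟨v, hg h _ _ hv⟩

theorem exists_convergesBelow {T : List Bool → List Bool} (hT : IsPerfectTree T)
    {g : List Bool → ℕ → Option ℕ} (hg : PrefixMonotone g)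
    (h : ∀ σ n, ∃ τ, (g (T (σ ++ τ)) n).isSome) (σ : List Bool) (N : ℕ) :
    ∃ τ, convergesBelow g (T (σ ++ τ)) N = true := by
  simp only [convergesBelow_iff]
  induction N with
  | zero => simp
  | succ N ih =>
    obtain ⟨τ, hτ⟩ := ih
    obtain ⟨ρ, hρ⟩ := h (σ ++ τ) N
    refine ⟨τ ++ ρ, fun i hi => ?_⟩
    rw [← List.append_assoc]
    rcases Nat.lt_succ_iff_lt_or_eq.1 hi with hi | rfl
    · exact hg.isSome (hT.mono (List.prefix_append _ _)) (hτ i hi)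
    · exact hρ

/-- Density of convergence makes the search for the least code of a suitable extension terminate, so
the extension is found computably. -/
theorem exists_computable_extension {T : List Bool → List Bool} (hT : IsPerfectTree T)
    {g : List Bool → ℕ → Option ℕ} (hgc : Computable₂ g) (hg : PrefixMonotone g)
    (h : ∀ σ n, ∃ τ, (g (T (σ ++ τ)) n).isSome) :
    ∃ e : List Bool → ℕ → List Bool, Computable₂ e ∧ (∀ σ N, σ <+: e σ N) ∧
      ∀ σ N, ∀ i < N, (g (T (e σ N)) i).isSome := by
  let c : (List Bool × ℕ) → ℕ → List Bool := fun p m =>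
    p.1 ++ (Encodable.decode (α := List Bool) m).getD []
  have hc : Computable₂ c :=
    Computable.list_append.comp (Computable.fst.comp Computable.fst)
      (Computable.option_getD (Computable.decode.comp Computable.snd) (Computable.const []))
  let P : (List Bool × ℕ) → ℕ → Prop := fun p m => convergesBelow g (T (c p m)) p.2 = true
  have hP : ComputablePred fun p : (List Bool × ℕ) × ℕ => P p.1 p.2 := by
    refine Computable.computablePred ?_
    refine (hgc.convergesBelow.comp (hT.computable.comp hc)
      (Computable.snd.comp Computable.fst)).of_eq fun p => ?_
    simp [P]
  have hex : ∀ p, ∃ m, P p m := fun p => by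
    obtain ⟨τ, hτ⟩ := exists_convergesBelow hT hg h p.1 p.2
    exact ⟨Encodable.encode τ, by simpa [P, c] using hτ⟩
  refine ⟨fun σ N => c (σ, N) (Nat.find (hex (σ, N))),
    hc.comp Computable.id (Computable.find hP hex), fun σ N => List.prefix_append _ _, ?_⟩
  intro σ N
  exact convergesBelow_iff.1 (Nat.find_spec (hex (σ, N)))

/-- Alternate between appending the next bit and extending until enough inputs converge. The bound
`2 ^ (σ.length + 1)` covers exactly the inputs whose binary logarithm is at most the level. -/
theorem exists_deciding_subtree {T : List Bool → List Bool} (hT : IsPerfectTree T)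
    {g : List Bool → ℕ → Option ℕ} (hgc : Computable₂ g) (hg : PrefixMonotone g)
    (h : ∀ σ n, ∃ τ, (g (T (σ ++ τ)) n).isSome) :
    ∃ S, IsPerfectTree S ∧ ∀ σ, ∀ i < 2 ^ (σ.length + 1), (g (T (S σ)) i).isSome := by
  obtain ⟨e, hec, hle, he⟩ := exists_computable_extension hT hgc hg h
  -- Recursion on the level with `σ` as a parameter makes computability a case of primitive
  -- recursion. Up to level `σ.length` the default bit is never read.
  let s : List Bool → ℕ → List Bool := fun σ k =>
    k.rec (e [] (2 ^ 1)) fun i ρ => e (ρ ++ [σ.getD i false]) (2 ^ (i + 1 + 1))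
  have hs : ∀ σ k, s σ (k + 1) = e (s σ k ++ [σ.getD k false]) (2 ^ (k + 1 + 1)) :=
    fun _ _ => rfl
  have hloc : ∀ σ b k, k ≤ σ.length → s (σ ++ [b]) k = s σ k := by
    intro σ b k
    induction k with
    | zero => exact fun _ => rfl
    | succ k ih =>
      intro hk
      rw [hs, hs, ih (by omega), List.getD_append _ _ _ _ (by omega)]
  refine ⟨fun σ => s σ σ.length, ⟨?_, fun σ b => ?_⟩, fun σ => ?_⟩
  · refine Computable.nat_rec
      (h := fun σ (q : ℕ × List Bool) => e (q.2 ++ [σ.getD q.1 false]) (2 ^ (q.1 + 1 + 1)))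
      Computable.list_length (Computable.const _) ?_
    have hpow : Computable₂ ((· ^ ·) : ℕ → ℕ → ℕ) := (Primrec₂.unpaired'.1 Nat.Primrec.pow).to_comp
    have h1 : Computable fun p : List Bool × ℕ × List Bool => p.2.1 :=
      Computable.fst.comp Computable.snd
    refine hec.comp (Computable.list_concat.comp (Computable.snd.comp Computable.snd) ?_)
      (hpow.comp (Computable.const 2) (Computable.succ.comp (Computable.succ.comp h1)))
    exact (Primrec.list_getD false).to_comp.comp Computable.fst h1
  · simp only [List.length_append, List.length_singleton, hs, hloc σ b _ le_rfl]
    simpa using hle (s σ σ.length ++ [b]) (2 ^ (σ.length + 1 + 1))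
  · show ∀ i < 2 ^ (σ.length + 1), (g (T (s σ σ.length)) i).isSome
    rcases σ.length with _ | k
    · exact he _ _
    · exact he _ _

/-! ### Traces read off a tree -/

/-- The `n`-th set consists of the values on input `n ≠ 0` of the functional `g` with oracle a
node of level `Nat.log 2 n` of the tree `T`. -/
def treeTrace (T : List Bool → List Bool) (g : List Bool → ℕ → Option ℕ) (n : ℕ) : Set ℕ :=
  {v | ∃ σ : List Bool, (2 ^ σ.length ≤ n ∧ n < 2 ^ (σ.length + 1)) ∧ g (T σ) n = some v}

theorem rePred_treeTrace {T : List Bool → List Bool} (hT : IsPerfectTree T)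
    {g : List Bool → ℕ → Option ℕ} (hg : Computable₂ g) :
    REPred fun p : ℕ × ℕ => p.2 ∈ treeTrace T g p.1 := by
  -- Numbers that code no string are sent to the root, which is harmless in an existential search
  -- over nodes.
  let d : ℕ → List Bool := fun m => (Encodable.decode (α := List Bool) m).getD []
  have hd : Computable d := Computable.option_getD Computable.decode (Computable.const [])
  have hpow : Primrec₂ ((· ^ ·) : ℕ → ℕ → ℕ) := Primrec₂.unpaired'.1 Nat.Primrec.pow
  have hl : Computable fun q : (ℕ × ℕ) × ℕ => (d q.2).length :=
    Computable.list_length.comp (hd.comp Computable.snd)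
  have hn : Computable fun q : (ℕ × ℕ) × ℕ => q.1.1 := Computable.fst.comp Computable.fst
  have h1 : Computable fun q : (ℕ × ℕ) × ℕ => decide (2 ^ (d q.2).length ≤ q.1.1) :=
    Primrec.nat_le.decide.to_comp.comp (hpow.to_comp.comp (Computable.const 2) hl) hn
  have h2 : Computable fun q : (ℕ × ℕ) × ℕ => decide (q.1.1 < 2 ^ ((d q.2).length + 1)) :=
    Primrec.nat_lt.decide.to_comp.comp hn
      (hpow.to_comp.comp (Computable.const 2) (Computable.succ.comp hl))
  have h3 : Computable fun q : (ℕ × ℕ) × ℕ => decide (g (T (d q.2)) q.1.1 = some q.1.2) :=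
    Primrec.eq.decide.to_comp.comp (hg.comp (hT.computable.comp (hd.comp Computable.snd)) hn)
      (Computable.option_some.comp (Computable.snd.comp Computable.fst))
  have h : Computable₂ fun (p : ℕ × ℕ) (m : ℕ) =>
      (decide (2 ^ (d m).length ≤ p.1) && decide (p.1 < 2 ^ ((d m).length + 1))) &&
        decide (g (T (d m)) p.1 = some p.2) :=
    Primrec.and.to_comp.comp (Primrec.and.to_comp.comp h1 h2) h3
  refine (Partrec.rfind h.partrec₂).dom_re.of_eq fun p => ?_
  rw [Nat.rfind_dom]
  constructor
  · rintro ⟨m, hm, -⟩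
    refine ⟨d m, ?_⟩
    simpa using hm
  · rintro ⟨σ, hσ⟩
    refine ⟨Encodable.encode σ, ?_, fun _ => trivial⟩
    have : d (Encodable.encode σ) = σ := by simp [d]
    simpa [this] using hσ

/-- Each node of level `Nat.log 2 n` contributes at most one value. For `n = 0` no level qualifies,
so the set is empty. -/
theorem finite_treeTrace (T : List Bool → List Bool) (g : List Bool → ℕ → Option ℕ) (n : ℕ) :
    (treeTrace T g n).Finite ∧ (treeTrace T g n).ncard ≤ n := by
  rcases n.eq_zero_or_pos with rfl | hn
  · have : treeTrace T g 0 = ∅ := by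
      ext v
      simp [treeTrace]
    simp [this]
  have hsub : treeTrace T g n ⊆
      Set.range fun w : List.Vector Bool (Nat.log 2 n) => (g (T w.1) n).getD 0 := by
    rintro v ⟨σ, ⟨h1, h2⟩, hv⟩
    exact ⟨⟨σ, (Nat.log_eq_of_pow_le_of_lt_pow h1 h2).symm⟩, by simp [hv]⟩
  refine ⟨(Set.finite_range _).subset hsub, ?_⟩
  calc (treeTrace T g n).ncard ≤ _ := Set.ncard_le_ncard hsub (Set.finite_range _)
    _ ≤ Nat.card (List.Vector Bool (Nat.log 2 n)) := by
        rw [← Set.image_univ, ← Set.ncard_univ]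
        exact Set.ncard_image_le Set.finite_univ
    _ = 2 ^ Nat.log 2 n := by rw [Nat.card_eq_fintype_card, card_vector, Fintype.card_bool]
    _ ≤ n := Nat.pow_log_le_self 2 hn.ne'

/-- The reals `x` at which `g` is not total or is traced by a trace bounded by the identity. -/
def TracedAt (g : List Bool → ℕ → Option ℕ) (x : ℕ → Bool) : Prop :=
  (∃ n, ∀ k, g (initSeg x k) n = none) ∨
    ∃ U : ℕ → Set ℕ, (REPred fun p : ℕ × ℕ => p.2 ∈ U p.1) ∧
      (∀ n, (U n).Finite ∧ (U n).ncard ≤ n) ∧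
      ∀ n, n ≠ 0 → ∃ k, ∃ v ∈ U n, g (initSeg x k) n = some v

/-- Either convergence is dense in `T` and a deciding subtree supplies the trace, or some node `ρ`
forces divergence at an input and the full subtree above `ρ` suffices. -/
theorem exists_subtree_tracedAt {T : List Bool → List Bool} (hT : IsPerfectTree T)
    {g : List Bool → ℕ → Option ℕ} (hgc : Computable₂ g) (hg : PrefixMonotone g) :
    ∃ S, IsPerfectTree S ∧ ∀ x, IsBranch (fun σ => T (S σ)) x → TracedAt g x := by
  by_cases h : ∀ σ n, ∃ τ, (g (T (σ ++ τ)) n).isSome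
  · obtain ⟨S, hS, hdec⟩ := exists_deciding_subtree hT hgc hg h
    have hTS := hT.comp hS
    refine ⟨S, hS, fun x hx => Or.inr ⟨treeTrace _ g, rePred_treeTrace hTS hgc,
      finite_treeTrace _ g, fun n hn => ?_⟩⟩
    -- The branch only provides a node of level at least `Nat.log 2 n`; truncating it gives one of
    -- exactly that level.
    obtain ⟨τ, hlen, hτ⟩ := hx (Nat.log 2 n)
    have hl : (τ.take (Nat.log 2 n)).length = Nat.log 2 n := by simpa using hlen
    have hlt := Nat.lt_pow_succ_log_self Nat.one_lt_two n
    obtain ⟨v, hv⟩ := Option.isSome_iff_exists.1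
      (hdec (τ.take (Nat.log 2 n)) n (by rwa [hl]))
    refine ⟨(T (S (τ.take (Nat.log 2 n)))).length, v, ⟨τ.take (Nat.log 2 n), ?_, hv⟩, ?_⟩
    · rw [hl]
      exact ⟨Nat.pow_log_le_self 2 hn, hlt⟩
    · rw [← hTS.eq_initSeg_of_prefix (List.take_prefix _ _) hτ]
      exact hv
  · push Not at h
    obtain ⟨ρ, n, hρ⟩ := h
    refine ⟨fun σ => ρ ++ σ, .append_left ρ, fun x hx => Or.inl ⟨n, fun k => ?_⟩⟩
    obtain ⟨σ, hσ, hx⟩ := hx k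
    by_contra hne
    -- Convergence on an initial segment of the branch would persist to a longer node above `ρ`.
    refine hρ σ (hg.isSome (σ := initSeg x k) ?_ (Option.isSome_iff_ne_none.2 hne))
    change initSeg x k <+: (fun σ => T ((fun σ => ρ ++ σ) σ)) σ
    rw [hx]
    refine initSeg_prefix x (hσ.trans ?_)
    exact (hT.comp (.append_left ρ)).length_le σ

theorem TracedAt.exists_trace {ε : ℝ} (hε : 0 ≤ ε) {g : List Bool → ℕ → Option ℕ} {x : ℕ → Bool}
    {φ : ℕ →. ℕ} (h : TracedAt g x) (hφ : ComputesAt g x φ) :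
    ∃ U : ℕ → Set ℕ, IsBoundedCETrace (fun n : ℕ => (n : ℝ) ^ (1 + ε)) U ∧
      ((∀ n, (φ n).Dom) → ∀ᶠ n in Filter.atTop, ∃ v ∈ φ n, v ∈ U n) := by
  rcases h with ⟨n, hn⟩ | ⟨U, hre, hU, hmem⟩
  · refine ⟨fun _ => ∅, ⟨?_, fun m => ⟨Set.finite_empty, ?_⟩⟩, fun htot => ?_⟩
    · exact (Partrec.none (α := ℕ × ℕ) (σ := ℕ)).dom_re.of_eq fun p => by simp
    · simp only [Set.ncard_empty, Nat.cast_zero]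
      positivity
    · obtain ⟨v, hv⟩ := Part.dom_iff_mem.1 (htot n)
      obtain ⟨k, hk⟩ := (hφ n v).1 hv
      simp [hn k] at hk
  · refine ⟨U, ⟨hre, fun n => ⟨(hU n).1, ?_⟩⟩, fun _ => ?_⟩
    · refine (Nat.cast_le.2 (hU n).2).trans ?_
      rcases n.eq_zero_or_pos with rfl | hn
      · simp only [Nat.cast_zero]
        positivity
      · exact Real.self_le_rpow_of_one_le (by exact_mod_cast hn) (by linarith)
    · filter_upwards [Filter.eventually_ne_atTop 0] with n hn
      obtain ⟨k, v, hv, hk⟩ := hmem n hn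
      exact ⟨v, (hφ n v).2 ⟨k, hk⟩, hv⟩

/-! ### Enumerating the functionals -/

/-- The prefix monotone computable functionals on finite oracles. -/
abbrev Functional : Type := {g : List Bool → ℕ → Option ℕ // Computable₂ g ∧ PrefixMonotone g}

instance : Countable Functional := by
  have h : ∀ g : Functional, ∃ c : Nat.Partrec.Code, c.eval = fun n =>
      Part.bind (Encodable.decode (α := List Bool × ℕ) n) fun a : List Bool × ℕ =>
        (Part.some (g.1 a.1 a.2)).map Encodable.encode :=
    fun g => Nat.Partrec.Code.exists_code.1 g.2.1
  choose c hc using h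
  -- A program for the encoded functional determines all of its values, and programs are countable.
  refine Function.Injective.countable (f := c) fun g g' hgg => ?_
  have heq := (hc g).symm.trans ((congrArg _ hgg).trans (hc g'))
  refine Subtype.ext (funext fun σ => funext fun n => ?_)
  have := congrFun heq (Encodable.encode (σ, n))
  simpa using this

theorem exists_functional_enumeration : ∃ G : ℕ → Functional, Function.Surjective G := by
  have : Nonempty Functional := ⟨⟨fun _ _ => none, Computable.const none, fun _ _ _ _ _ h => h⟩⟩
  exact exists_surjective_nat Functional

theorem exists_real_of_chain (s : ℕ → List Bool) (hs : ∀ k, s k <+: s (k + 1))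
    (hlen : ∀ k, k ≤ (s k).length) :
    ∃ x : ℕ → Bool, ∀ k, s k = initSeg x (s k).length := by
  have mono : ∀ {j k}, j ≤ k → s j <+: s k := fun {j k} h =>
    Nat.le_induction List.prefix_rfl (fun k _ ih => ih.trans (hs k)) k h
  refine ⟨fun i => (s (i + 1)).getD i false, fun k => ?_⟩
  refine List.ext_getElem (by simp) fun i hi _ => ?_
  have hi' : i < (s (i + 1)).length := hlen (i + 1)
  simp only [initSeg, List.getElem_map, List.getElem_range, List.getD_eq_getElem _ _ hi']
  rcases le_total k (i + 1) with h | h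
  · exact (mono h).getElem hi
  · exact ((mono h).getElem hi').symm

/-! ### Continuum many branches through decreasing trees -/

/-- The bundled computable perfect trees. -/
abbrev PerfectTree : Type := {T : List Bool → List Bool // IsPerfectTree T}

/-- The decreasing sequence of trees obtained by applying the refinements `D` and following
the path `α`. -/
def treeSeq (D : PerfectTree → ℕ → PerfectTree) (α : ℕ → Bool) : ℕ → PerfectTree
  | 0 => ⟨fun σ => σ, .id⟩
  | k + 1 => ⟨fun σ => (treeSeq D α k).1 ((D (treeSeq D α k) k).1 ([α k] ++ σ)),
      (treeSeq D α k).2.comp ((D (treeSeq D α k) k).2.comp (.append_left [α k]))⟩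

section treeSeq

variable {D : PerfectTree → ℕ → PerfectTree} {α β : ℕ → Bool}

theorem treeSeq_congr {k : ℕ} (h : ∀ i < k, α i = β i) : treeSeq D α k = treeSeq D β k := by
  induction k with
  | zero => rfl
  | succ k ih =>
    simp only [treeSeq, ih fun i hi => h i (hi.trans k.lt_succ_self), h k k.lt_succ_self]

/-- All later trees lie inside the refinement made at stage `k`, and each stage pushes the root at
least one level up. Their roots therefore witness that the limit real is a branch of that
refinement. -/
theorem exists_treeSeq_eq_comp (k j : ℕ) : ∃ R, IsPerfectTree R ∧ j ≤ (R []).length ∧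
    ∀ σ, (treeSeq D α (k + 1 + j)).1 σ =
      (treeSeq D α k).1 ((D (treeSeq D α k) k).1 (R σ)) := by
  induction j with
  | zero => exact ⟨_, .append_left [α k], by simp, fun _ => rfl⟩
  | succ j ih =>
    obtain ⟨R, hR, hlen, heq⟩ := ih
    refine ⟨_, hR.comp ((D (treeSeq D α (k + 1 + j)) (k + 1 + j)).2.comp
      (.append_left [α (k + 1 + j)])), ?_, fun σ => heq _⟩
    have h1 := hR.length_add_le
      ((D (treeSeq D α (k + 1 + j)) (k + 1 + j)).1 ([α (k + 1 + j)] ++ []))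
    have h2 := (D (treeSeq D α (k + 1 + j)) (k + 1 + j)).2.length_le ([α (k + 1 + j)] ++ [])
    simp only [List.length_append, List.length_singleton, List.length_nil] at h2
    omega

theorem exists_real_treeSeq (D : PerfectTree → ℕ → PerfectTree) (α : ℕ → Bool) :
    ∃ x : ℕ → Bool, ∀ k, (treeSeq D α k).1 [] = initSeg x ((treeSeq D α k).1 []).length := by
  have step : ∀ k, (treeSeq D α k).1 [] <+: (treeSeq D α (k + 1)).1 [] := fun k =>
    (treeSeq D α k).2.mono List.nil_prefix
  refine exists_real_of_chain _ step fun k => ?_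
  rcases k with _ | k
  · simp
  · induction k with
    | zero => exact ((treeSeq D α 0).2.comp (D (treeSeq D α 0) 0).2).length_le ([α 0] ++ [])
    | succ k ih =>
      have h1 := (treeSeq D α (k + 1)).2.length_add_le
        ((D (treeSeq D α (k + 1)) (k + 1)).1 ([α (k + 1)] ++ []))
      have h2 := (D (treeSeq D α (k + 1)) (k + 1)).2.length_le ([α (k + 1)] ++ [])
      simp only [List.length_append, List.length_singleton, List.length_nil] at h2
      exact (by omega : k + 1 + 1 ≤ _).trans h1

theorem isBranch_of_treeSeq {x : ℕ → Bool}
    (hx : ∀ k, (treeSeq D α k).1 [] = initSeg x ((treeSeq D α k).1 []).length) (k : ℕ) :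
    IsBranch (fun σ => (treeSeq D α k).1 ((D (treeSeq D α k) k).1 σ)) x := by
  intro m
  obtain ⟨R, -, hlen, heq⟩ := exists_treeSeq_eq_comp (D := D) (α := α) k m
  refine ⟨R [], hlen, ?_⟩
  have := hx (k + 1 + m)
  rwa [heq] at this

/-- The path is decoded from `x` bit by bit: the refined tree at stage `k` depends only on the bits
of the path below `k`, and the bit of `x` just after its root is the `k`-th bit of the path. -/
theorem eq_of_treeSeq {x : ℕ → Bool}
    (hα : ∀ k, (treeSeq D α k).1 [] = initSeg x ((treeSeq D α k).1 []).length)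
    (hβ : ∀ k, (treeSeq D β k).1 [] = initSeg x ((treeSeq D β k).1 []).length) : α = β := by
  have next : ∀ {γ : ℕ → Bool},
      (∀ k, (treeSeq D γ k).1 [] = initSeg x ((treeSeq D γ k).1 []).length) → ∀ k,
      (treeSeq D γ k).1 ((D (treeSeq D γ k) k).1 []) ++ [γ k] = initSeg x
        (((treeSeq D γ k).1 ((D (treeSeq D γ k) k).1 [])).length + 1) := by
    intro γ hγ k
    have hp := ((treeSeq D γ k).2.comp (D (treeSeq D γ k) k).2).append_prefix [] (γ k)
    have := eq_initSeg_of_prefix (hγ (k + 1) ▸ hp)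
    simpa using this
  funext k
  induction k using Nat.strong_induction_on with
  | _ k ih =>
    have h1 := next hα k
    rw [treeSeq_congr ih, ← next hβ k] at h1
    simpa using h1

end treeSeq

theorem exists_injective_tracedAt :
    ∃ X : (ℕ → Bool) → ℕ → Bool, Function.Injective X ∧ ∀ α (g : Functional), TracedAt g.1 (X α) := by
  obtain ⟨G, hG⟩ := exists_functional_enumeration
  have h : ∀ (T : PerfectTree) (k : ℕ), ∃ S : PerfectTree,
      ∀ x, IsBranch (fun σ => T.1 (S.1 σ)) x → TracedAt (G k).1 x := fun T k => by
    obtain ⟨S, hS, h⟩ := exists_subtree_tracedAt T.2 (G k).2.1 (G k).2.2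
    exact ⟨⟨S, hS⟩, h⟩
  choose D hD using h
  choose X hX using exists_real_treeSeq D
  refine ⟨X, fun α β hαβ => eq_of_treeSeq (hX α) (hαβ ▸ hX β), fun α g => ?_⟩
  obtain ⟨k, rfl⟩ := hG g
  exact hD _ k _ (isBranch_of_treeSeq (hX α) k)

theorem isJumpTraceable_of_tracedAt {ε : ℝ} (hε : 0 ≤ ε) {x : ℕ → Bool}
    (h : ∀ g : Functional, TracedAt g.1 x) :
    IsJumpTraceable (fun n : ℕ => (n : ℝ) ^ (1 + ε)) x := by
  intro φ hφ
  obtain ⟨g, hg, hm, hc⟩ := exists_primrec_computesAt_of_recursiveIn hφ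
  exact (h ⟨g, hg.to_comp, hm⟩).exists_trace hε hc

theorem mainTheorem11 (ε : ℚ) (hε : 0 < ε) :
    Cardinal.mk {x : ℕ → Bool // IsJumpTraceable (fun n : ℕ => (n : ℝ) ^ (1 + (ε : ℝ))) x} =
      Cardinal.continuum := by
  have hmk : Cardinal.mk (ℕ → Bool) = Cardinal.continuum := by simp
  refine le_antisymm (hmk ▸ Cardinal.mk_subtype_le _) ?_
  obtain ⟨X, hX, hT⟩ := exists_injective_tracedAt
  have hε' : (0 : ℝ) ≤ ε := by exact_mod_cast hε.le
  rw [← hmk]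
  exact Cardinal.mk_le_of_injective
    (f := fun α => ⟨X α, isJumpTraceable_of_tracedAt hε' (hT α)⟩)
    fun α β h => hX (congrArg Subtype.val h)
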